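/- **Conventions.** All groups are abelian; a rank-1 group is a torsion-free abelian group of rank $1$. Let $\Pi$ be the set of primes. A characteristic is a sequence $(t_p)_{p\in\Pi}$ with $t_p\in\mathbb N\cup\{\infty\}$, $0 \in \mathbb N$; two characteristics are equivalent if they differ in only finitely many entries and both entries are finite wherever they differ. A type is an equivalence class of characteristics. The set $\mathcal T$ of all types is ordered by $\sigma\le\tau$ if there are representatives $(s_p)$ of $\sigma$ and $(t_p)$ of $\tau$ with $s_p\le t_p$ for all $p$; it is a lattice, with join and meet induced by the pointwise maximum and minimum. The type $t(T)$ of a rank-1 group $T$ is the class of $(h_p(x))_{p\in\Pi}$ for any $0\ne x\in T$, where $h_p(x)=\sup\{n \mid x\in p^nT\}$. A cotorsion theory is a pair $(\mathcal F,\mathcal C)$ of classes of abelian groups with $\mathcal F={}^\perp\mathcal C=\{Y\mid \operatorname{Ext}(Y,X)=0\ \text{for all } X\in\mathcal C\}$ and $\mathcal C=\mathcal F^\perp=\{X\mid\operatorname{Ext}(Y,X)=0\ \text{for all } Y\in\mathcal F\}$. Cotorsion theories are ordered by $(\mathcal F,\mathcal C)\le(\mathcal F',\mathcal C')$ if $\mathcal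 C\subseteq\mathcal C'$. A rational cotorsion theory is one of the form $({}^\perp(T^\perp),T^\perp)$ with $T$ a rank-1 group, where $T^\perp=\{X\mid\operatorname{Ext}(T,X)=0\}$. Let $\mathcal C_{\mathrm{rat}}$ be the collection of all rational cotorsion theories with the induced order. **Theorem 1.11.** The lattice of types $(\mathcal T,\le)$ is anti-isomorphic to the lattice of rational cotorsion theories $(\mathcal C_{\mathrm{rat}},\le)$ via the mapping $$\Phi:\ \tau=t(T)\longmapsto\bigl({}^\perp(T^\perp),\,T^\perp\bigr).$$ That is, $\Phi$ is a well-defined bijection $\mathcal T\to\mathcal C_{\mathrm{rat}}$ with $\sigma\le\tau$ if and only if $\Phi(\tau)\le\Phi(\sigma)$; in particular $\mathcal C_{\mathrm{rat}}$ is a lattice in its order, and, with infimum and supremum taken in $\mathcal C_{\mathrm{rat}}$, $\Phi(\sigma\vee\tau)=\Phi(\sigma)\wedge\Phi(\tau)$ and $\Phi(\sigma\wedge\tau)=\Phi(\sigma)\vee\Phi(\tau)$ for all types $\sigma,\tau$. -/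

import Mathlib

universe u

/-! ### Types -/

/-- A characteristic: a sequence `(t_p)`, indexed by the primes, with `t_p ∈ ℕ ∪ {∞}`. -/
abbrev Characteristic : Type := Nat.Primes → ℕ∞

namespace Characteristic

/-- Two characteristics are equivalent if they differ in only finitely many entries, and
both entries are finite wherever they differ. -/
def Equivalent (χ ψ : Characteristic) : Prop :=
  {p | χ p ≠ ψ p}.Finite ∧ ∀ p, χ p ≠ ψ p → χ p ≠ ⊤ ∧ ψ p ≠ ⊤

theorem equivalent_equivalence : Equivalence Equivalent where
  refl χ := ⟨by simp, fun p h => (h rfl).elim⟩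
  symm {χ ψ} h := ⟨by simpa only [ne_comm] using h.1, fun p hp => (h.2 p hp.symm).symm⟩
  trans {χ ψ ω} h k := by
    refine ⟨(h.1.union k.1).subset fun p hp => ?_, fun p hp => ?_⟩
    · by_contra hc
      simp only [Set.mem_union, Set.mem_ofPred_eq, not_or, not_not] at hc
      exact hp (hc.1.trans hc.2)
    · by_cases h1 : χ p = ψ p
      · by_cases h2 : ψ p = ω p
        · exact (hp (h1.trans h2)).elim
        · exact ⟨h1 ▸ (k.2 p h2).1, (k.2 p h2).2⟩
      · by_cases h2 : ψ p = ω p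
        · exact ⟨(h.2 p h1).1, h2 ▸ (h.2 p h1).2⟩
        · exact ⟨(h.2 p h1).1, (k.2 p h2).2⟩

instance setoid : Setoid Characteristic := ⟨Equivalent, equivalent_equivalence⟩

/-- `χ p ≤ ψ p` for all but finitely many `p`, and `χ p` is finite at the exceptions. -/
def AlmostLE (χ ψ : Characteristic) : Prop :=
  {p | ¬ χ p ≤ ψ p}.Finite ∧ ∀ p, ¬ χ p ≤ ψ p → χ p ≠ ⊤

theorem AlmostLE.of_le {χ ψ : Characteristic} (h : χ ≤ ψ) : AlmostLE χ ψ :=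
  ⟨by simp [show ∀ p, χ p ≤ ψ p from h], fun p hp => (hp (h p)).elim⟩

theorem AlmostLE.trans {χ ψ ω : Characteristic} (h : AlmostLE χ ψ) (k : AlmostLE ψ ω) :
    AlmostLE χ ω := by
  refine ⟨(h.1.union k.1).subset fun p hp => ?_, fun p hp => ?_⟩
  · by_contra hc
    simp only [Set.mem_union, Set.mem_ofPred_eq, not_or, not_not] at hc
    exact hp (hc.1.trans hc.2)
  · by_cases h1 : χ p ≤ ψ p
    · intro ht
      have h3 : ψ p = ⊤ := top_le_iff.1 (ht ▸ h1)
      exact k.2 p (fun h2 => hp (h1.trans h2)) h3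
    · exact h.2 p h1

theorem equivalent_iff {χ ψ : Characteristic} :
    Equivalent χ ψ ↔ AlmostLE χ ψ ∧ AlmostLE ψ χ := by
  constructor
  · rintro ⟨h, k⟩
    refine ⟨⟨h.subset fun p hp he => hp he.le, fun p hp => (k p fun he => hp he.le).1⟩,
      ⟨h.subset fun p hp he => hp he.ge, fun p hp => (k p fun he => hp he.ge).2⟩⟩
  · rintro ⟨⟨h1, k1⟩, ⟨h2, k2⟩⟩
    refine ⟨(h1.union h2).subset fun p hp => ?_, fun p hp => ?_⟩
    · rcases lt_or_gt_of_ne hp with h | h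
      · exact Or.inr h.not_ge
      · exact Or.inl h.not_ge
    · rcases lt_or_gt_of_ne hp with h | h
      · exact ⟨h.ne_top, k2 p h.not_ge⟩
      · exact ⟨k1 p h.not_ge, h.ne_top⟩

theorem AlmostLE.sup {χ ψ ω : Characteristic} (h : AlmostLE χ ω) (k : AlmostLE ψ ω) :
    AlmostLE (χ ⊔ ψ) ω := by
  refine ⟨(h.1.union k.1).subset fun p hp => ?_, fun p hp ht => ?_⟩
  · by_contra hc
    simp only [Set.mem_union, Set.mem_ofPred_eq, not_or, not_not] at hc
    exact hp (sup_le hc.1 hc.2)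
  · rw [Pi.sup_apply] at hp ht
    rcases le_total (χ p) (ψ p) with hle | hle
    · rw [sup_eq_right.2 hle] at hp ht
      exact k.2 p hp ht
    · rw [sup_eq_left.2 hle] at hp ht
      exact h.2 p hp ht

theorem AlmostLE.inf {χ ψ ω : Characteristic} (h : AlmostLE χ ψ) (k : AlmostLE χ ω) :
    AlmostLE χ (ψ ⊓ ω) := by
  refine ⟨(h.1.union k.1).subset fun p hp => ?_, fun p hp => ?_⟩
  · by_contra hc
    simp only [Set.mem_union, Set.mem_ofPred_eq, not_or, not_not] at hc
    exact hp (le_inf hc.1 hc.2)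
  · by_cases h1 : χ p ≤ ψ p
    · exact k.2 p fun h2 => hp (le_inf h1 h2)
    · exact h.2 p h1

theorem Equivalent.sup {χ χ' ψ ψ' : Characteristic} (h : Equivalent χ χ')
    (k : Equivalent ψ ψ') : Equivalent (χ ⊔ ψ) (χ' ⊔ ψ') := by
  rw [equivalent_iff] at *
  exact ⟨(h.1.trans (.of_le le_sup_left)).sup (k.1.trans (.of_le le_sup_right)),
    (h.2.trans (.of_le le_sup_left)).sup (k.2.trans (.of_le le_sup_right))⟩

theorem Equivalent.inf {χ χ' ψ ψ' : Characteristic} (h : Equivalent χ χ')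
    (k : Equivalent ψ ψ') : Equivalent (χ ⊓ ψ) (χ' ⊓ ψ') := by
  rw [equivalent_iff] at *
  exact ⟨(AlmostLE.trans (.of_le inf_le_left) h.1).inf (AlmostLE.trans (.of_le inf_le_right) k.1),
    (AlmostLE.trans (.of_le inf_le_left) h.2).inf (AlmostLE.trans (.of_le inf_le_right) k.2)⟩

end Characteristic

/-- A type is an equivalence class of characteristics. -/
def GroupType : Type := Quotient Characteristic.setoid

namespace GroupType

/-- The type represented by a characteristic. -/
def mk (χ : Characteristic) : GroupType := Quotient.mk _ χ

theorem mk_eq_mk {χ ψ : Characteristic} : mk χ = mk ψ ↔ χ.Equivalent ψ := Quotient.eq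

/-- `σ ≤ τ` if there are representatives with `s_p ≤ t_p` for all primes `p`. -/
instance : LE GroupType where
  le σ τ := ∃ χ ψ : Characteristic, mk χ = σ ∧ mk ψ = τ ∧ ∀ p, χ p ≤ ψ p

theorem mk_le_mk {χ ψ : Characteristic} : mk χ ≤ mk ψ ↔ χ.AlmostLE ψ := by
  constructor
  · rintro ⟨χ', ψ', h1, h2, h⟩
    rw [mk_eq_mk, Characteristic.equivalent_iff] at h1 h2
    exact h1.2.trans (.trans (.of_le h) h2.1)
  · intro h
    refine ⟨χ ⊓ ψ, ψ, ?_, rfl, fun p => inf_le_right⟩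
    rw [mk_eq_mk, Characteristic.equivalent_iff]
    exact ⟨.of_le inf_le_left, .inf (.of_le le_rfl) h⟩

/-- The lattice of types; joins and meets are induced by the pointwise maximum and minimum. -/
noncomputable instance : Lattice GroupType where
  le_refl σ := by
    induction σ using Quotient.inductionOn with | _ χ => exact ⟨χ, χ, rfl, rfl, fun _ => le_rfl⟩
  le_trans σ τ ρ := by
    induction σ using Quotient.inductionOn with | _ χ
    induction τ using Quotient.inductionOn with | _ ψ
    induction ρ using Quotient.inductionOn with | _ ω
    exact fun h k => mk_le_mk.2 ((mk_le_mk.1 h).trans (mk_le_mk.1 k))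
  le_antisymm σ τ := by
    induction σ using Quotient.inductionOn with | _ χ
    induction τ using Quotient.inductionOn with | _ ψ
    exact fun h k => mk_eq_mk.2 (Characteristic.equivalent_iff.2 ⟨mk_le_mk.1 h, mk_le_mk.1 k⟩)
  sup := Quotient.map₂ (· ⊔ ·) fun _ _ h _ _ k => Characteristic.Equivalent.sup h k
  inf := Quotient.map₂ (· ⊓ ·) fun _ _ h _ _ k => Characteristic.Equivalent.inf h k
  le_sup_left σ τ := by
    induction σ using Quotient.inductionOn with | _ χ
    induction τ using Quotient.inductionOn with | _ ψ
    exact mk_le_mk.2 (.of_le le_sup_left)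
  le_sup_right σ τ := by
    induction σ using Quotient.inductionOn with | _ χ
    induction τ using Quotient.inductionOn with | _ ψ
    exact mk_le_mk.2 (.of_le le_sup_right)
  sup_le σ τ ρ := by
    induction σ using Quotient.inductionOn with | _ χ
    induction τ using Quotient.inductionOn with | _ ψ
    induction ρ using Quotient.inductionOn with | _ ω
    exact fun h k => mk_le_mk.2 ((mk_le_mk.1 h).sup (mk_le_mk.1 k))
  inf_le_left σ τ := by
    induction σ using Quotient.inductionOn with | _ χ
    induction τ using Quotient.inductionOn with | _ ψ
    exact mk_le_mk.2 (.of_le inf_le_left)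
  inf_le_right σ τ := by
    induction σ using Quotient.inductionOn with | _ χ
    induction τ using Quotient.inductionOn with | _ ψ
    exact mk_le_mk.2 (.of_le inf_le_right)
  le_inf σ τ ρ := by
    induction σ using Quotient.inductionOn with | _ χ
    induction τ using Quotient.inductionOn with | _ ψ
    induction ρ using Quotient.inductionOn with | _ ω
    exact fun h k => mk_le_mk.2 ((mk_le_mk.1 h).inf (mk_le_mk.1 k))

end GroupType

/-! ### Rank-1 groups and their types -/

/-- A rank-1 group: a torsion-free abelian group of rank `1`. -/
structure IsRankOne (T : Type u) [AddCommGroup T] : Prop where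
  torsionFree : IsAddTorsionFree T
  rank_eq_one : Module.rank ℤ T = 1

/-- The `p`-height of `x`: the supremum in `ℕ ∪ {∞}` of all `n` such that `x ∈ pⁿ T`. -/
noncomputable def pHeight {T : Type u} [AddCommGroup T] (x : T) (p : Nat.Primes) : ℕ∞ :=
  ⨆ (n : ℕ) (_ : ∃ y : T, (p : ℕ) ^ n • y = x), (n : ℕ∞)

/-- The type of an element: the class of its sequence of heights. -/
noncomputable def elementType {T : Type u} [AddCommGroup T] (x : T) : GroupType :=
  GroupType.mk (pHeight x)

theorem IsRankOne.exists_ne_zero {T : Type u} [AddCommGroup T] (hT : IsRankOne T) :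
    ∃ x : T, x ≠ 0 := by
  by_contra! h
  have : Subsingleton T := ⟨fun a b => (h a).trans (h b).symm⟩
  have h1 := hT.rank_eq_one
  rw [rank_subsingleton'] at h1
  exact zero_ne_one h1

/-- The type `t(T)` of a rank-1 group `T`: the type of any nonzero element of `T`
(see `IsRankOne.type_eq` for the independence of the element). -/
noncomputable def IsRankOne.type {T : Type u} [AddCommGroup T] (hT : IsRankOne T) : GroupType :=
  elementType hT.exists_ne_zero.choose

theorem elementType_zsmul {T : Type u} [AddCommGroup T] [IsAddTorsionFree T] (x : T) (m : ℤ)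
    (hm : m ≠ 0) : elementType (m • x) = elementType x := by
  have key : ∀ p : Nat.Primes, pHeight (m • x) p ≤ pHeight x p + (padicValInt p m : ℕ∞) := by
    intro p
    have hp : Fact (p : ℕ).Prime := ⟨p.2⟩
    refine iSup₂_le fun n ⟨y, hy⟩ => ?_
    rcases le_total n (padicValInt p m) with h | h
    · exact le_trans (by exact_mod_cast h) le_add_self
    obtain ⟨k, rfl⟩ := Nat.exists_eq_add_of_le h
    obtain ⟨c, hc⟩ : ((p : ℕ) : ℤ) ^ padicValInt p m ∣ m := by
      rw [padicValInt_dvd_iff]; exact Or.inr le_rfl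
    have hcop : IsCoprime (((p : ℕ) : ℤ) ^ k) c := by
      refine IsCoprime.pow_left ((Nat.prime_iff_prime_int.1 p.2).coprime_iff_not_dvd.2 ?_)
      rintro ⟨d, hd⟩
      have h2 : ((p : ℕ) : ℤ) ^ (padicValInt p m + 1) ∣ m :=
        ⟨d, by rw [pow_succ, mul_assoc, ← hd]; exact hc⟩
      rw [padicValInt_dvd_iff] at h2
      omega
    have hy' : (((p : ℕ) : ℤ) ^ k) • y = c • x := by
      have h3 : (((p : ℕ) : ℤ) ^ padicValInt p m) • ((((p : ℕ) : ℤ) ^ k) • y) =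
          (((p : ℕ) : ℤ) ^ padicValInt p m) • (c • x) := by
        rw [smul_smul, smul_smul, ← pow_add, ← hc, ← hy]
        exact_mod_cast natCast_zsmul y _
      exact zsmul_right_injective (pow_ne_zero _ (by exact_mod_cast p.2.ne_zero)) h3
    obtain ⟨a, b, hab⟩ := hcop
    have hx : (p : ℕ) ^ k • (a • x + b • y) = x := by
      have : (((p : ℕ) : ℤ) ^ k) • (a • x + b • y) = x := by
        rw [smul_add, smul_comm _ b y, hy', smul_smul, smul_smul, ← add_smul,
          mul_comm _ a, hab, one_smul]
      rw [← natCast_zsmul]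
      exact_mod_cast this
    have h4 : (k : ℕ∞) ≤ pHeight x p :=
      le_iSup₂_of_le (f := fun (n : ℕ) (_ : ∃ y : T, (p : ℕ) ^ n • y = x) => (n : ℕ∞))
        k ⟨_, hx⟩ le_rfl
    push_cast
    rw [add_comm]
    gcongr
  have key2 : ∀ p : Nat.Primes, pHeight x p ≤ pHeight (m • x) p := by
    intro p
    refine iSup₂_le fun n ⟨y, hy⟩ => ?_
    exact le_iSup₂_of_le
      (f := fun (n : ℕ) (_ : ∃ y : T, (p : ℕ) ^ n • y = m • x) => (n : ℕ∞))
      n ⟨m • y, by rw [smul_comm, hy]⟩ le_rfl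
  refine GroupType.mk_eq_mk.2 (Characteristic.equivalent_iff.2 ⟨⟨?_, ?_⟩, .of_le key2⟩)
  · have hfin : {p : Nat.Primes | (p : ℕ) ∈ m.natAbs.primeFactors}.Finite :=
      (Finset.finite_toSet m.natAbs.primeFactors).preimage Nat.Primes.coe_nat_injective.injOn
    refine hfin.subset fun p hp => ?_
    by_contra hc
    have hnd : ¬ (p : ℕ) ∣ m.natAbs := by
      intro hd
      exact hc (Nat.mem_primeFactors.2 ⟨p.2, hd, Int.natAbs_ne_zero.2 hm⟩)
    apply hp
    have := key p
    rw [padicValInt, padicValNat.eq_zero_of_not_dvd hnd] at this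
    simpa using this
  · intro p hp ht
    have h1 := key p
    rw [ht, top_le_iff] at h1
    rcases ENat.add_eq_top.1 h1 with h1 | h1
    · exact hp (h1 ▸ le_top)
    · exact ENat.natCast_ne_top _ h1

theorem IsRankOne.type_eq {T : Type u} [AddCommGroup T] (hT : IsRankOne T) (x : T)
    (hx : x ≠ 0) : elementType x = hT.type := by
  have := hT.torsionFree
  set y := hT.exists_ne_zero.choose with hy
  have hy0 : y ≠ 0 := hT.exists_ne_zero.choose_spec
  have hdep : ¬ LinearIndependent ℤ ![x, y] := by
    intro h
    have h1 := h.cardinal_lift_le_rank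
    rw [hT.rank_eq_one] at h1
    simp at h1
  rw [LinearIndependent.pair_iff] at hdep
  push Not at hdep
  obtain ⟨s, t, hst, h0⟩ := hdep
  have hs : s ≠ 0 := by
    rintro rfl
    have ht : t ≠ 0 := h0 rfl
    rw [zero_smul, zero_add] at hst
    exact hy0 ((smul_eq_zero.1 hst).resolve_left ht)
  have ht : t ≠ 0 := by
    rintro rfl
    rw [zero_smul, add_zero] at hst
    exact hx ((smul_eq_zero.1 hst).resolve_left hs)
  have h2 : s • x = (-t) • y := by rw [neg_smul]; exact eq_neg_of_add_eq_zero_left hst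
  calc elementType x = elementType (s • x) := (elementType_zsmul x s hs).symm
    _ = elementType y := by rw [h2, elementType_zsmul y (-t) (neg_ne_zero.2 ht)]

/-! ### Cotorsion theories -/

/-- `Ext(A, B) = 0` for abelian groups `A` and `B`. -/
def ExtVanishes (A B : ModuleCat.{u} ℤ) : Prop :=
  Subsingleton (CategoryTheory.Abelian.Ext A B 1)

/-- `𝒜^⊥`, the class of all `X` with `Ext(A, X) = 0` for all `A ∈ 𝒜`. -/
def rightPerp (𝒜 : Set (ModuleCat.{u} ℤ)) : Set (ModuleCat.{u} ℤ) :=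
  {X | ∀ A ∈ 𝒜, ExtVanishes A X}

/-- `^⊥ℬ`, the class of all `Y` with `Ext(Y, X) = 0` for all `X ∈ ℬ`. -/
def leftPerp (ℬ : Set (ModuleCat.{u} ℤ)) : Set (ModuleCat.{u} ℤ) :=
  {Y | ∀ X ∈ ℬ, ExtVanishes Y X}

/-- A cotorsion theory `(ℱ, 𝒞)`: a pair of classes of abelian groups, each of which is maximal
with `Ext(F, C) = 0` for all `F ∈ ℱ`, `C ∈ 𝒞`, that is, `ℱ = ^⊥𝒞` and `𝒞 = ℱ^⊥`. -/
@[ext]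
structure CotorsionTheory : Type (u + 1) where
  torsionFreeClass : Set (ModuleCat.{u} ℤ)
  cotorsionClass : Set (ModuleCat.{u} ℤ)
  torsionFreeClass_eq : torsionFreeClass = leftPerp cotorsionClass
  cotorsionClass_eq : cotorsionClass = rightPerp torsionFreeClass

namespace CotorsionTheory

/-- Cotorsion theories are ordered by inclusion of the cotorsion classes. -/
instance : PartialOrder CotorsionTheory.{u} where
  le P Q := P.cotorsionClass ⊆ Q.cotorsionClass
  le_refl _ := subset_rfl
  le_trans _ _ _ h k := Set.Subset.trans h k
  le_antisymm P Q h k := by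
    have hC : P.cotorsionClass = Q.cotorsionClass := Set.Subset.antisymm h k
    exact CotorsionTheory.ext
      (by rw [P.torsionFreeClass_eq, Q.torsionFreeClass_eq, hC]) hC

/-- The cotorsion theory `(^⊥(𝒜^⊥), 𝒜^⊥)` cogenerated by a class `𝒜`. -/
def cogeneratedBy (𝒜 : Set (ModuleCat.{u} ℤ)) : CotorsionTheory.{u} where
  torsionFreeClass := leftPerp (rightPerp 𝒜)
  cotorsionClass := rightPerp 𝒜
  torsionFreeClass_eq := rfl
  cotorsionClass_eq := Set.Subset.antisymm (fun X hX _ hY => hY X hX)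
    (fun _ hX A hA => hX A fun _ hY => hY A hA)

/-- The cotorsion theory `(^⊥(T^⊥), T^⊥)` cogenerated by a single group `T`. -/
def cogeneratedByGroup (T : Type u) [AddCommGroup T] : CotorsionTheory.{u} :=
  cogeneratedBy {ModuleCat.of ℤ T}

/-- A rational cotorsion theory is one that is cogenerated by a rank-1 group. -/
def IsRational (P : CotorsionTheory.{u}) : Prop :=
  ∃ (T : Type u) (_ : AddCommGroup T), IsRankOne T ∧ P = cogeneratedByGroup T

end CotorsionTheory

/-- The rational cotorsion theories, with the order inherited from `CotorsionTheory`. -/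
abbrev RationalCotorsionTheory : Type (u + 1) :=
  {P : CotorsionTheory.{u} // P.IsRational}

/-! If `t(S) ≤ t(T)`, multiplying a nonzero element of `T` by an integer repairs the finitely many
deficient heights, so `S` embeds in `T` (`IsRankOne.exists_injective`). Since quotients of injective
abelian groups are injective, vanishing of `Ext(-, X)` passes to subgroups, so `T^⊥ ⊆ S^⊥`.

For the converse, a rank-1 group is the union of a chain of cyclic groups generated by the quotients
of one element by a divisibility chain of denominators. The telescope presentation of this union
turns `Ext(T, X) = 0` into solvability of `b n - k n • b (n + 1) = a n` in `X`, with `k` the ratios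
of consecutive denominators (`IsRankOne.extVanishes_iff`). If the characteristic `χ` of `S` is not
almost below the characteristic `ψ` of `T`, some `X` has solvable equations for `ψ` but not for `χ`
(`exists_separating_of_not_almostLE`). If `χ p = ∞ > ψ p` for some `p`, the integers localized at
`p` serve, by a counting argument. If `χ p > ψ p` for infinitely many `p`, a kernel of a map from a
product of cyclic groups onto `ℚ` serves.

Every type is realized by a subgroup of `ℚ`, so these two directions give the anti-isomorphism. -/

open CategoryTheory

/-! ### Vanishing of `Ext` -/

/-- Given a presentation `0 → K → F → T → 0` with `F` projective, `Ext(T, X) = 0` if and only if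
every homomorphism `K → X` extends to `F`. -/
theorem extVanishes_iff_of_presentation {K F T X : Type u} [AddCommGroup K] [AddCommGroup F]
    [AddCommGroup T] [AddCommGroup X] [Module.Projective ℤ F] (i : K →ₗ[ℤ] F) (q : F →ₗ[ℤ] T)
    (hi : Function.Injective i) (hiq : Function.Exact i q) (hq : Function.Surjective q) :
    ExtVanishes (ModuleCat.of ℤ T) (ModuleCat.of ℤ X) ↔
      ∀ f : K →ₗ[ℤ] X, ∃ g : F →ₗ[ℤ] X, g ∘ₗ i = f := by
  let S : ShortComplex (ModuleCat.{u} ℤ) := ShortComplex.mk (ModuleCat.ofHom i)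
    (ModuleCat.ofHom q) (by
      rw [← ModuleCat.ofHom_comp, hiq.linearMap_comp_eq_zero]; rfl)
  have hS : S.ShortExact :=
    { exact := (ShortComplex.ShortExact.moduleCat_exact_iff_function_exact S).2 hiq
      mono_f := (ModuleCat.mono_iff_injective _).2 hi
      epi_g := (ModuleCat.epi_iff_surjective _).2 hq }
  have hF : Projective S.X₂ := (IsProjective.iff_projective F).1 inferInstance
  constructor
  · intro h f
    have : Subsingleton (Abelian.Ext (ModuleCat.of ℤ T) (ModuleCat.of ℤ X) 1) := h
    obtain ⟨g, hg⟩ := Abelian.Ext.contravariant_sequence_exact₁ hS (ModuleCat.of ℤ X)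
      (Abelian.Ext.mk₀ (ModuleCat.ofHom f)) (n₁ := 1) rfl (Subsingleton.elim (α :=
        Abelian.Ext (ModuleCat.of ℤ T) (ModuleCat.of ℤ X) 1) _ _)
    obtain ⟨g, rfl⟩ := (Abelian.Ext.mk₀_bijective _ _).2 g
    rw [Abelian.Ext.mk₀_comp_mk₀] at hg
    have := (Abelian.Ext.mk₀_bijective _ _).1 hg
    exact ⟨g.hom, congrArg ModuleCat.Hom.hom this⟩
  · intro h
    refine subsingleton_of_forall_eq 0 fun e => ?_
    obtain ⟨f, rfl⟩ := Abelian.Ext.contravariant_sequence_exact₃ hS (ModuleCat.of ℤ X) e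
      (Abelian.Ext.eq_zero_of_projective _) (n₀ := 0) rfl
    obtain ⟨f, rfl⟩ := (Abelian.Ext.mk₀_bijective _ _).2 f
    obtain ⟨g, hg⟩ := h f.hom
    have : f = S.f ≫ ModuleCat.ofHom g := ModuleCat.hom_ext hg.symm
    -- The connecting map sends `f` to `e`, and kills every map that factors through `S.f`.
    rw [this, ← Abelian.Ext.mk₀_comp_mk₀, hS.extClass_comp_assoc]

/-- Every quotient of an injective abelian group is injective. -/
theorem injective_quotient {D : Type u} [AddCommGroup D] [inst : Module ℤ D]
    [Module.Injective ℤ D] (N : Submodule ℤ D) : Module.Injective ℤ (D ⧸ N) := by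
  obtain rfl : inst = AddCommGroup.toIntModule D := Subsingleton.elim _ _
  have hdiv : ∀ {n : ℤ} (_ : n ≠ 0), Function.Surjective fun x : D ⧸ N => n • x := by
    intro n hn x
    obtain ⟨d, rfl⟩ := N.mkQ_surjective x
    -- Injectivity extends `1 ↦ d` along multiplication by `n` on `ℤ`; then `g 1` is a quotient of
    -- `d` by `n`.
    obtain ⟨g, hg⟩ := (Module.Baer.of_injective (R := ℤ) (Q := D) inferInstance).extension_property
      (LinearMap.mulLeft ℤ n) (mul_right_injective₀ hn) (LinearMap.toSpanSingleton ℤ D d)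
    refine ⟨N.mkQ (g 1), ?_⟩
    have := LinearMap.congr_fun hg 1
    simp only [LinearMap.comp_apply, LinearMap.mulLeft_apply, LinearMap.toSpanSingleton_apply,
      one_smul, mul_one] at this
    rw [← this]
    change n • N.mkQ (g 1) = _
    rw [← map_smul, ← map_smul, smul_eq_mul, mul_one]
  let : DivisibleBy (D ⧸ N) ℤ := divisibleByOfSMulRightSurj (D ⧸ N) ℤ hdiv
  exact (Module.Baer.of_divisible (D ⧸ N)).injective

/-- Vanishing of `Ext¹(-, X)` passes to subobjects if `X` has an injective resolution of
length one. -/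
theorem subsingleton_ext_of_mono {C : Type*} [Category* C] [Abelian C] [HasExt.{u} C]
    {E : ShortComplex C} (hE : E.ShortExact) [Injective E.X₂] [Injective E.X₃] {S T : C}
    (j : S ⟶ T) [Mono j] [Subsingleton (Abelian.Ext T E.X₁ 1)] :
    Subsingleton (Abelian.Ext S E.X₁ 1) := by
  refine subsingleton_of_forall_eq 0 fun e => ?_
  obtain ⟨f, rfl⟩ := Abelian.Ext.covariant_sequence_exact₁ S hE e
    (Abelian.Ext.eq_zero_of_injective _) (n₀ := 0) rfl
  obtain ⟨f, rfl⟩ := (Abelian.Ext.mk₀_bijective _ _).2 f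
  -- Injectivity of `E.X₃` extends `f` to `T`, so the class is pulled back from `Ext(T, E.X₁) = 0`.
  rw [← Injective.comp_factorThru f j, ← Abelian.Ext.mk₀_comp_mk₀,
    Abelian.Ext.comp_assoc_of_second_deg_zero,
    Subsingleton.elim ((Abelian.Ext.mk₀ (Injective.factorThru f j)).comp
      hE.extClass (zero_add 1)) 0, Abelian.Ext.comp_zero]

/-- If `Ext(T, X) = 0` then `Ext(S, X) = 0` for every group `S` embedded in `T`. -/
theorem ExtVanishes.of_injective {S T : Type u} {X : ModuleCat.{u} ℤ} [AddCommGroup S]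
    [AddCommGroup T] (j : S →ₗ[ℤ] T) (hj : Function.Injective j)
    (h : ExtVanishes (ModuleCat.of ℤ T) X) : ExtVanishes (ModuleCat.of ℤ S) X := by
  have hQ : Injective (Limits.cokernel (Injective.ι X)) := by
    let D : ModuleCat.{u} ℤ := Injective.under X
    have : Module.Injective ℤ D :=
      (Module.injective_iff_injective_object ℤ D).2 (Injective.injective_under X)
    have : Injective (ModuleCat.of ℤ (D ⧸ (Injective.ι X).hom.range)) :=
      (Module.injective_iff_injective_object ℤ _).1 (injective_quotient _)
    refine Injective.of_iso (ModuleCat.cokernelIsoRangeQuotient (Injective.ι X)).symm ?_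
    convert this
    exact Subsingleton.elim _ _
  have hmono : Mono (ModuleCat.ofHom j) := (ModuleCat.mono_iff_injective _).2 hj
  let E : ShortComplex (ModuleCat.{u} ℤ) :=
    ShortComplex.mk (Injective.ι X) (Limits.cokernel.π (Injective.ι X))
      (Limits.cokernel.condition _)
  have hE : E.ShortExact :=
    { exact := ShortComplex.exact_cokernel _
      mono_f := Injective.ι_mono X
      epi_g := Limits.coequalizer.π_epi }
  have : Injective E.X₂ := Injective.injective_under X
  have : Injective E.X₃ := hQ
  have : Subsingleton (Abelian.Ext (ModuleCat.of ℤ T) E.X₁ 1) := h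
  exact subsingleton_ext_of_mono hE (ModuleCat.ofHom j)

/-- The version of `extVanishes_iff_of_presentation` with a presentation in the lowest universe. -/
theorem extVanishes_iff_of_presentation_zero {K F : Type} {T X : Type u} [AddCommGroup K]
    [AddCommGroup F] [AddCommGroup T] [AddCommGroup X] [Module.Projective ℤ F] (i : K →ₗ[ℤ] F)
    (q : F →ₗ[ℤ] T) (hi : Function.Injective i) (hiq : Function.Exact i q)
    (hq : Function.Surjective q) :
    ExtVanishes (ModuleCat.of ℤ T) (ModuleCat.of ℤ X) ↔
      ∀ f : K →ₗ[ℤ] X, ∃ g : F →ₗ[ℤ] X, g ∘ₗ i = f := by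
  let eK : ULift.{u} K ≃ₗ[ℤ] K := ULift.moduleEquiv
  let eF : ULift.{u} F ≃ₗ[ℤ] F := ULift.moduleEquiv
  have : Module.Projective ℤ (ULift.{u} F) := Module.Projective.of_equiv eF.symm
  rw [extVanishes_iff_of_presentation (eF.symm.toLinearMap ∘ₗ i ∘ₗ eK.toLinearMap)
    (q ∘ₗ eF.toLinearMap)]
  · constructor
    · intro h f
      obtain ⟨g, hg⟩ := h (f ∘ₗ eK.toLinearMap)
      refine ⟨g ∘ₗ eF.symm.toLinearMap, LinearMap.ext fun x => ?_⟩
      exact LinearMap.congr_fun hg (eK.symm x)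
    · intro h f
      obtain ⟨g, hg⟩ := h (f ∘ₗ eK.symm.toLinearMap)
      refine ⟨g ∘ₗ eF.toLinearMap, LinearMap.ext fun x => ?_⟩
      exact LinearMap.congr_fun hg (eK x)
  · exact eF.symm.injective.comp (hi.comp eK.injective)
  · intro x
    change q (eF x) = 0 ↔ _
    rw [hiq]
    constructor
    · rintro ⟨y, hy⟩
      exact ⟨eK.symm y, eF.injective (by simpa using hy)⟩
    · rintro ⟨y, rfl⟩
      exact ⟨eK y, by simp⟩
  · exact hq.comp eF.surjective

/-! ### Direct limits of sequences of infinite cyclic groups -/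

/-- The system of equations `b n - k n • b (n + 1) = a n` is solvable in `X` for every right-hand
side, that is, `lim¹` of the inverse system `X ← X ← X ← ⋯` with maps `k n` vanishes. -/
def TelescopeSolvable (k : ℕ → ℕ) (X : Type u) [AddCommGroup X] : Prop :=
  ∀ a : ℕ → X, ∃ b : ℕ → X, ∀ n, b n - k n • b (n + 1) = a n

/-- The endomorphism `eₙ ↦ eₙ - kₙ eₙ₊₁` of the free group on `e₀, e₁, …`. -/
noncomputable def telescopeMap (k : ℕ → ℕ) : (ℕ →₀ ℤ) →ₗ[ℤ] (ℕ →₀ ℤ) :=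
  Finsupp.linearCombination ℤ fun n => Finsupp.single n 1 - k n • Finsupp.single (n + 1) 1

theorem telescopeMap_single (k : ℕ → ℕ) (n : ℕ) :
    telescopeMap k (Finsupp.single n 1) =
      Finsupp.single n 1 - k n • Finsupp.single (n + 1) 1 := by
  simp [telescopeMap]

theorem telescopeMap_apply_zero (k : ℕ → ℕ) (c : ℕ →₀ ℤ) : telescopeMap k c 0 = c 0 := by
  induction c using Finsupp.induction_linear with
  | zero => simp
  | add f g hf hg => simp [hf, hg]
  | single n a =>
    rcases n with _ | n <;> simp [telescopeMap]

theorem telescopeMap_apply_succ (k : ℕ → ℕ) (c : ℕ →₀ ℤ) (n : ℕ) :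
    telescopeMap k c (n + 1) = c (n + 1) - k n * c n := by
  induction c using Finsupp.induction_linear with
  | zero => simp
  | add f g hf hg => simp [hf, hg]; ring
  | single m a =>
    by_cases h : m = n
    · subst h; simp [telescopeMap]; ring
    · by_cases h' : m = n + 1 <;> simp [telescopeMap, h, h']

/-- The map is triangular with unit diagonal, so the coordinates of a kernel element vanish
successively. -/
theorem telescopeMap_injective (k : ℕ → ℕ) : Function.Injective (telescopeMap k) := by
  rw [← LinearMap.ker_eq_bot, LinearMap.ker_eq_bot']
  intro c hc
  ext n
  induction n with
  | zero => rw [← telescopeMap_apply_zero k, hc]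
  | succ n ih =>
    have := telescopeMap_apply_succ k c n
    rw [hc, ih] at this
    simpa using this.symm

/-- Modulo the range, `eₙ` equals `kₙ eₙ₊₁`, so the terms of a finite sum can all be pushed to one
common index. A relation among the `y n` thereby reduces to `a • y n = 0`. -/
theorem exists_sub_single_mem_range_telescopeMap (k : ℕ → ℕ) (c : ℕ →₀ ℤ) :
    ∃ (n : ℕ) (a : ℤ), c - Finsupp.single n a ∈ LinearMap.range (telescopeMap k) := by
  have step : ∀ (n : ℕ) (a : ℤ), Finsupp.single n a - Finsupp.single (n + 1) (a * k n) ∈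
      LinearMap.range (telescopeMap k) := fun n a =>
    ⟨Finsupp.single n a, by simp [telescopeMap, smul_sub]⟩
  have steps : ∀ (n d : ℕ) (a : ℤ), ∃ b : ℤ,
      Finsupp.single n a - Finsupp.single (n + d) b ∈ LinearMap.range (telescopeMap k) := by
    intro n d a
    induction d with
    | zero => exact ⟨a, by simp⟩
    | succ d ih =>
      obtain ⟨b, hb⟩ := ih
      exact ⟨b * k (n + d), by simpa [add_assoc] using add_mem hb (step (n + d) b)⟩
  induction c using Finsupp.induction_linear with
  | zero => exact ⟨0, 0, by simp⟩
  | single n a => exact ⟨n, a, by simp⟩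
  | add f g hf hg =>
    obtain ⟨n, a, ha⟩ := hf
    obtain ⟨m, b, hb⟩ := hg
    obtain ⟨a', ha'⟩ := steps n m a
    obtain ⟨b', hb'⟩ := steps m n b
    refine ⟨n + m, a' + b', ?_⟩
    rw [add_comm m n] at hb'
    have := add_mem (add_mem ha ha') (add_mem hb hb')
    rw [Finsupp.single_add]
    convert this using 1
    abel

/-- A sequence `y` with `y n = k n • y (n + 1)` satisfies no relations besides these. -/
theorem exact_telescopeMap {T : Type u} [AddCommGroup T] [IsAddTorsionFree T] (k : ℕ → ℕ)
    (y : ℕ → T) (hy : ∀ n, y n = k n • y (n + 1)) (hy0 : ∀ n, y n ≠ 0) :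
    Function.Exact (telescopeMap k) (Finsupp.linearCombination ℤ y) := by
  have hcomp : ∀ c, Finsupp.linearCombination ℤ y (telescopeMap k c) = 0 := by
    intro c
    induction c using Finsupp.induction_linear with
    | zero => simp
    | add f g hf hg => simp [hf, hg]
    | single n a =>
      simp only [telescopeMap, Finsupp.linearCombination_single, map_smul, map_sub, map_nsmul,
        one_smul]
      rw [← hy, sub_self, smul_zero]
  intro c
  constructor
  · intro hc
    obtain ⟨n, a, d, hd⟩ := exists_sub_single_mem_range_telescopeMap k c
    have h1 := hcomp d
    rw [hd, map_sub, hc, Finsupp.linearCombination_single, zero_sub, neg_eq_zero,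
      smul_eq_zero] at h1
    rw [h1.resolve_right (hy0 n), Finsupp.single_zero, sub_zero] at hd
    exact ⟨d, hd⟩
  · rintro ⟨d, rfl⟩
    exact hcomp d

/-- `Ext(T, X)` vanishes for the direct limit `T` of `ℤ → ℤ → ⋯` with maps `k n` if and only if
`lim¹` vanishes for the inverse system `X ← X ← ⋯` with maps `k n`. -/
theorem extVanishes_iff_telescopeSolvable {T X : Type u} [AddCommGroup T] [AddCommGroup X]
    [IsAddTorsionFree T] (k : ℕ → ℕ) (y : ℕ → T) (hy : ∀ n, y n = k n • y (n + 1))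
    (hy0 : ∀ n, y n ≠ 0) (hgen : ∀ t, ∃ (n : ℕ) (c : ℤ), t = c • y n) :
    ExtVanishes (ModuleCat.of ℤ T) (ModuleCat.of ℤ X) ↔ TelescopeSolvable k X := by
  rw [extVanishes_iff_of_presentation_zero (telescopeMap k) (Finsupp.linearCombination ℤ y)
    (telescopeMap_injective k) (exact_telescopeMap k y hy hy0)
    (fun t => by
      obtain ⟨n, c, rfl⟩ := hgen t
      exact ⟨Finsupp.single n c, Finsupp.linearCombination_single ℤ c n⟩)]
  constructor
  · intro h a
    obtain ⟨g, hg⟩ := h (Finsupp.linearCombination ℤ a)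
    refine ⟨fun n => g (Finsupp.single n 1), fun n => ?_⟩
    have := LinearMap.congr_fun hg (Finsupp.single n 1)
    rw [LinearMap.comp_apply, telescopeMap_single, map_sub, map_nsmul,
      Finsupp.linearCombination_single, one_smul] at this
    exact this
  · intro h f
    obtain ⟨b, hb⟩ := h fun n => f (Finsupp.single n 1)
    refine ⟨Finsupp.linearCombination ℤ b, Finsupp.lhom_ext' fun n => LinearMap.ext_ring ?_⟩
    simp only [LinearMap.comp_apply, Finsupp.lsingle_apply, telescopeMap_single, map_sub,
      map_nsmul, Finsupp.linearCombination_single, one_smul, hb]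

/-- A direct limit of infinite cyclic groups embeds in every torsion-free group containing a
compatible sequence of nonzero elements. -/
theorem exists_injective_of_telescope {S T : Type u} [AddCommGroup S] [AddCommGroup T]
    [IsAddTorsionFree S] [IsAddTorsionFree T] (k : ℕ → ℕ) (y : ℕ → S)
    (hy : ∀ n, y n = k n • y (n + 1)) (hy0 : ∀ n, y n ≠ 0)
    (hgen : ∀ t, ∃ (n : ℕ) (c : ℤ), t = c • y n) (z : ℕ → T)
    (hz : ∀ n, z n = k n • z (n + 1)) (hz0 : ∀ n, z n ≠ 0) :
    ∃ j : S →ₗ[ℤ] T, Function.Injective j := by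
  let f := Finsupp.linearCombination ℤ y
  let g := Finsupp.linearCombination ℤ z
  have hf : Function.Surjective f := fun t => by
    obtain ⟨n, c, rfl⟩ := hgen t
    exact ⟨Finsupp.single n c, Finsupp.linearCombination_single ℤ c n⟩
  have hker : LinearMap.ker f = LinearMap.ker g :=
    (exact_telescopeMap k y hy hy0).linearMap_ker_eq.trans
      (exact_telescopeMap k z hz hz0).linearMap_ker_eq.symm
  refine ⟨(LinearMap.ker f).liftQ g hker.le ∘ₗ (f.quotKerEquivOfSurjective hf).symm.toLinearMap,
    ?_⟩
  rw [LinearMap.coe_comp]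
  refine Function.Injective.comp ?_ (f.quotKerEquivOfSurjective hf).symm.injective
  rw [← LinearMap.ker_eq_bot]
  exact Submodule.ker_liftQ_eq_bot _ _ _ hker.ge

/-! ### Denominators admitted by a characteristic -/

namespace Characteristic

/-- `a` is a denominator admitted by `χ`: it is nonzero and its `p`-adic valuation is at most `χ p`
for all primes `p`. -/
def Admits (χ : Characteristic) (a : ℕ) : Prop :=
  a ≠ 0 ∧ ∀ (p : Nat.Primes) (e : ℕ), (p : ℕ) ^ e ∣ a → (e : ℕ∞) ≤ χ p

variable {χ : Characteristic}

theorem Admits.one : χ.Admits 1 := by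
  refine ⟨one_ne_zero, fun p e h => ?_⟩
  have := (Nat.pow_eq_one.1 (Nat.dvd_one.1 h)).resolve_left p.2.one_lt.ne'
  simp [this]

theorem Admits.of_dvd {a b : ℕ} (h : χ.Admits b) (hab : a ∣ b) : χ.Admits a :=
  ⟨ne_zero_of_dvd_ne_zero h.1 hab, fun p e he => h.2 p e (he.trans hab)⟩

theorem Admits.lcm {a b : ℕ} (ha : χ.Admits a) (hb : χ.Admits b) : χ.Admits (a.lcm b) := by
  refine ⟨Nat.lcm_ne_zero ha.1 hb.1, fun p e h => ?_⟩
  rw [p.2.pow_dvd_iff_le_factorization (Nat.lcm_ne_zero ha.1 hb.1),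
    Nat.factorization_lcm ha.1 hb.1, Finsupp.sup_apply, le_sup_iff,
    ← p.2.pow_dvd_iff_le_factorization ha.1, ← p.2.pow_dvd_iff_le_factorization hb.1] at h
  exact h.elim (ha.2 p e) (hb.2 p e)

theorem admits_prime_pow {p : Nat.Primes} {e : ℕ} : χ.Admits ((p : ℕ) ^ e) ↔ (e : ℕ∞) ≤ χ p := by
  refine ⟨fun h => h.2 p e dvd_rfl, fun h => ⟨pow_ne_zero _ p.2.ne_zero, fun q f hq => ?_⟩⟩
  rcases Nat.eq_zero_or_pos f with rfl | hf
  · simp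
  have hqp : q = p := Subtype.ext <| (Nat.prime_dvd_prime_iff_eq q.2 p.2).1 <|
    q.2.dvd_of_dvd_pow ((dvd_pow_self _ hf.ne').trans hq)
  subst hqp
  exact le_trans (by exact_mod_cast (Nat.pow_dvd_pow_iff_le_right q.2.one_lt).1 hq) h

open Classical in
/-- The least common multiple of the denominators up to `n` that `χ` admits. -/
noncomputable def denom (χ : Characteristic) (n : ℕ) : ℕ :=
  ((Finset.Icc 1 n).filter χ.Admits).lcm id

theorem admits_denom (χ : Characteristic) (n : ℕ) : χ.Admits (χ.denom n) := by
  classical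
  have : ∀ s : Finset ℕ, (∀ a ∈ s, χ.Admits a) → χ.Admits (s.lcm id) := by
    intro s
    induction s using Finset.induction_on with
    | empty => intro _; simpa using Admits.one
    | insert a s _ ih =>
      intro h
      rw [Finset.lcm_insert]
      exact (h a (by simp)).lcm (ih fun b hb => h b (by simp [hb]))
  exact this _ fun a ha => (Finset.mem_filter.1 ha).2

theorem denom_ne_zero (χ : Characteristic) (n : ℕ) : χ.denom n ≠ 0 := (χ.admits_denom n).1

theorem Admits.dvd_denom {a n : ℕ} (h : χ.Admits a) (hn : a ≤ n) : a ∣ χ.denom n := by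
  classical
  exact Finset.dvd_lcm (f := id)
    (Finset.mem_filter.2 ⟨Finset.mem_Icc.2 ⟨Nat.pos_of_ne_zero h.1, hn⟩, h⟩)

theorem denom_dvd_denom (χ : Characteristic) {m n : ℕ} (h : m ≤ n) : χ.denom m ∣ χ.denom n := by
  classical
  exact Finset.lcm_mono (Finset.filter_subset_filter _ (Finset.Icc_subset_Icc_right h))

theorem denom_zero (χ : Characteristic) : χ.denom 0 = 1 := by simp [denom]

/-- The quotient of consecutive denominators. -/
noncomputable def ratio (χ : Characteristic) (n : ℕ) : ℕ := χ.denom (n + 1) / χ.denom n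

theorem denom_succ (χ : Characteristic) (n : ℕ) :
    χ.denom (n + 1) = χ.denom n * χ.ratio n :=
  (Nat.mul_div_cancel' (χ.denom_dvd_denom n.le_succ)).symm

theorem ratio_ne_zero (χ : Characteristic) (n : ℕ) : χ.ratio n ≠ 0 := fun h =>
  χ.denom_ne_zero (n + 1) (by rw [denom_succ, h, mul_zero])

end Characteristic

/-! ### Heights and denominators -/

/-- Divisibility by a power of `p` implies divisibility by all smaller powers, so finite lower
bounds on the supremum are attained. -/
theorem le_pHeight_iff {T : Type u} [AddCommGroup T] {x : T} {p : Nat.Primes} {n : ℕ} :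
    (n : ℕ∞) ≤ pHeight x p ↔ ∃ y : T, (p : ℕ) ^ n • y = x := by
  constructor
  · intro h
    by_contra hn
    have hlt : pHeight x p ≤ (n - 1 : ℕ) := by
      refine iSup₂_le fun m ⟨y, hy⟩ => ?_
      by_contra hm
      have hm : n - 1 < m := by exact_mod_cast not_le.1 hm
      refine hn ⟨(p : ℕ) ^ (m - n) • y, ?_⟩
      rw [smul_smul, ← pow_add, Nat.add_sub_cancel' (by omega), hy]
    have h1 : n ≤ n - 1 := by exact_mod_cast h.trans hlt
    -- Subtraction is truncated, so `n = 0` survives; there `x` itself is the witness.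
    have h0 : n = 0 := by omega
    exact hn ⟨x, by simp [h0]⟩
  · intro h
    exact le_iSup₂_of_le (f := fun (n : ℕ) (_ : ∃ y : T, (p : ℕ) ^ n • y = x) => (n : ℕ∞))
      n h le_rfl

theorem exists_smul_eq_of_coprime {T : Type u} [AddCommGroup T] {x : T} {a b : ℕ}
    (hab : a.Coprime b) (ha : ∃ y : T, a • y = x) (hb : ∃ y : T, b • y = x) :
    ∃ y : T, (a * b) • y = x := by
  obtain ⟨y, hy⟩ := ha
  obtain ⟨z, hz⟩ := hb
  obtain ⟨u, v, huv⟩ := Nat.isCoprime_iff_coprime.2 hab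
  refine ⟨u • z + v • y, ?_⟩
  calc (a * b) • (u • z + v • y) = u • a • b • z + v • b • a • y := by module
    _ = (u * a + v * b) • x := by rw [hy, hz]; module
    _ = x := by rw [huv, one_smul]

/-- An element is divisible by `a` if and only if its heights admit `a` as a denominator. -/
theorem admits_pHeight_iff {T : Type u} [AddCommGroup T] {x : T} {a : ℕ} (ha : a ≠ 0) :
    Characteristic.Admits (pHeight x) a ↔ ∃ y : T, a • y = x := by
  constructor
  · induction a using Nat.recOnPosPrimePosCoprime with
    | prime_pow p n hp hn =>
      intro h
      exact le_pHeight_iff.1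
        ((Characteristic.admits_prime_pow (χ := pHeight x) (p := ⟨p, hp⟩)).1 h)
    | zero => exact (ha rfl).elim
    | one => exact fun _ => ⟨x, one_smul _ _⟩
    | coprime a b ha hb hab iha ihb =>
      intro h
      exact exists_smul_eq_of_coprime hab (iha (by omega) (h.of_dvd (dvd_mul_right a b)))
        (ihb (by omega) (h.of_dvd (dvd_mul_left b a)))
  · rintro ⟨y, hy⟩
    refine ⟨ha, fun p e ⟨c, hc⟩ => le_pHeight_iff.2 ⟨c • y, ?_⟩⟩
    rw [smul_smul, ← hc, hy]

/-- If the heights of `z` dominate `χ`, then `z` is divisible by all denominators of `χ`, in a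
compatible way. -/
theorem exists_telescope {T : Type u} [AddCommGroup T] [IsAddTorsionFree T] (χ : Characteristic)
    {z : T} (hz : z ≠ 0) (h : χ ≤ pHeight z) :
    ∃ y : ℕ → T, (∀ n, χ.denom n • y n = z) ∧ (∀ n, y n = χ.ratio n • y (n + 1)) ∧
      ∀ n, y n ≠ 0 := by
  have hex : ∀ n, ∃ y : T, χ.denom n • y = z := fun n =>
    (admits_pHeight_iff (χ.denom_ne_zero n)).1
      ⟨χ.denom_ne_zero n, fun p e he => ((χ.admits_denom n).2 p e he).trans (h p)⟩
  choose y hy using hex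
  refine ⟨y, hy, fun n => ?_, fun n h0 => hz (by rw [← hy n, h0, smul_zero])⟩
  apply nsmul_right_injective (χ.denom_ne_zero n)
  change χ.denom n • y n = χ.denom n • χ.ratio n • y (n + 1)
  rw [smul_smul, ← χ.denom_succ, hy, hy]

/-- Rank one makes `t` and `x` dependent; the coefficient of `t` cannot vanish because `x` is not
torsion. -/
theorem IsRankOne.exists_zsmul_eq {T : Type u} [AddCommGroup T] (hT : IsRankOne T) {x : T}
    (hx : x ≠ 0) (t : T) : ∃ (a : ℕ) (b : ℤ), a ≠ 0 ∧ a • t = b • x := by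
  have := hT.torsionFree
  have hdep : ¬ LinearIndependent ℤ ![t, x] := by
    intro h
    have h1 := h.cardinal_lift_le_rank
    rw [hT.rank_eq_one] at h1
    simp at h1
  rw [LinearIndependent.pair_iff] at hdep
  push Not at hdep
  obtain ⟨r, s, hrs, h0⟩ := hdep
  have hr : r ≠ 0 := by
    rintro rfl
    rw [zero_smul, zero_add] at hrs
    exact (smul_eq_zero.1 hrs).elim (h0 rfl) hx
  have hrt : r • t = (-s) • x := by rw [neg_smul]; exact eq_neg_of_add_eq_zero_left hrs
  rcases Int.natAbs_eq r with h | h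
  · exact ⟨r.natAbs, -s, Int.natAbs_ne_zero.2 hr, by rw [← natCast_zsmul, ← h, hrt]⟩
  · refine ⟨r.natAbs, s, Int.natAbs_ne_zero.2 hr, ?_⟩
    rw [← natCast_zsmul, ← neg_inj, ← neg_smul, ← h, hrt, neg_smul]

theorem IsRankOne.exists_coprime_zsmul_eq {T : Type u} [AddCommGroup T] (hT : IsRankOne T) {x : T}
    (hx : x ≠ 0) (t : T) : ∃ (a : ℕ) (b : ℤ), a ≠ 0 ∧ IsCoprime (a : ℤ) b ∧ a • t = b • x := by
  have := hT.torsionFree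
  obtain ⟨a, b, ha, hab⟩ := hT.exists_zsmul_eq hx t
  have hg : 0 < Int.gcd a b := Int.gcd_pos_of_ne_zero_left _ (by exact_mod_cast ha)
  obtain ⟨g, a', b', hg0, hcop, ha', hb'⟩ := Int.exists_gcd_one' hg
  have ha0 : 0 ≤ a' := by
    by_contra hneg
    have : (a : ℤ) < 0 := by
      rw [ha']; exact mul_neg_of_neg_of_pos (not_le.1 hneg) (by exact_mod_cast hg0)
    omega
  lift a' to ℕ using ha0
  refine ⟨a', b', ?_, Int.isCoprime_iff_gcd_eq_one.2 hcop, ?_⟩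
  · rintro rfl
    simp at ha'
    exact ha ha'
  · apply nsmul_right_injective hg0.ne'
    change g • a' • t = g • b' • x
    have h1 : a = g * a' := by rw [mul_comm]; exact_mod_cast ha'
    rw [smul_smul, ← h1, hab, hb', ← natCast_zsmul, smul_smul, mul_comm]

/-- A rank-1 group is the union of the cyclic groups generated by the quotients of a nonzero
element `x` by the denominators its heights admit. -/
theorem IsRankOne.exists_eq_zsmul {T : Type u} [AddCommGroup T] (hT : IsRankOne T) {x : T}
    (hx : x ≠ 0) (y : ℕ → T) (hy : ∀ n, Characteristic.denom (pHeight x) n • y n = x) (t : T) :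
    ∃ (n : ℕ) (c : ℤ), t = c • y n := by
  have := hT.torsionFree
  obtain ⟨a, b, ha, ⟨u, v, huv⟩, hab⟩ := hT.exists_coprime_zsmul_eq hx t
  have hdiv : a • (u • x + v • t) = x := by
    calc a • (u • x + v • t) = (u * a) • x + v • a • t := by module
      _ = (u * a + v * b) • x := by rw [hab]; module
      _ = x := by rw [huv, one_smul]
  have hadm := (admits_pHeight_iff ha).2 ⟨_, hdiv⟩
  obtain ⟨c, hc⟩ := hadm.dvd_denom le_rfl
  -- Stage `a` suffices, since an admitted `a` divides `denom a`.
  refine ⟨a, b * c, nsmul_right_injective ha ?_⟩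
  change a • t = a • (b * c) • y a
  rw [hab]
  nth_rewrite 1 [← hy a]
  rw [hc]
  module

/-- The criterion for `Ext(T, X) = 0`, for `T` of rank 1. -/
theorem IsRankOne.extVanishes_iff {T X : Type u} [AddCommGroup T] [AddCommGroup X]
    (hT : IsRankOne T) {x : T} (hx : x ≠ 0) :
    ExtVanishes (ModuleCat.of ℤ T) (ModuleCat.of ℤ X) ↔
      TelescopeSolvable (Characteristic.ratio (pHeight x)) X := by
  have := hT.torsionFree
  obtain ⟨y, hy, hk, hy0⟩ := exists_telescope (pHeight x) hx le_rfl
  exact extVanishes_iff_telescopeSolvable _ y hk hy0 (hT.exists_eq_zsmul hx y hy)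

theorem pHeight_add_le {T : Type u} [AddCommGroup T] (z : T) (p : Nat.Primes) {m e : ℕ}
    (h : (p : ℕ) ^ e ∣ m) : pHeight z p + e ≤ pHeight (m • z) p := by
  obtain ⟨c, rfl⟩ := h
  refine ENat.forall_natCast_le_iff_le.1 fun n hn => ?_
  rw [le_pHeight_iff]
  rcases le_total n e with hne | hne
  · refine ⟨((p : ℕ) ^ (e - n) * c) • z, ?_⟩
    rw [smul_smul, ← mul_assoc, ← pow_add, Nat.add_sub_cancel' hne]
  · obtain ⟨d, rfl⟩ := Nat.exists_eq_add_of_le' hne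
    obtain ⟨y, rfl⟩ := le_pHeight_iff.1 ((ENat.add_le_add_iff_right (ENat.natCast_ne_top e)).1
      (by exact_mod_cast hn : (d : ℕ∞) + e ≤ pHeight z p + e))
    exact ⟨c • y, by rw [smul_smul, smul_smul]; congr 1; ring⟩

/-- A rank-1 group embeds in every rank-1 group of larger type. -/
theorem IsRankOne.exists_injective {S T : Type u} [AddCommGroup S] [AddCommGroup T]
    (hS : IsRankOne S) (hT : IsRankOne T) (h : hS.type ≤ hT.type) :
    ∃ j : S →ₗ[ℤ] T, Function.Injective j := by
  classical
  have := hS.torsionFree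
  have := hT.torsionFree
  obtain ⟨x, hx⟩ := hS.exists_ne_zero
  obtain ⟨z, hz⟩ := hT.exists_ne_zero
  rw [← hS.type_eq x hx, ← hT.type_eq z hz, elementType, elementType, GroupType.mk_le_mk] at h
  -- At each exceptional prime this factor alone supplies the height of `x`; `toNat` loses nothing
  -- because `AlmostLE` makes those heights finite.
  let m : ℕ := ∏ p ∈ h.1.toFinset, (p : ℕ) ^ (pHeight x p).toNat
  have hm : m ≠ 0 := Finset.prod_ne_zero_iff.2 fun p _ => pow_ne_zero _ p.2.ne_zero
  have hle : pHeight x ≤ pHeight (m • z) := by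
    intro p
    by_cases hp : pHeight x p ≤ pHeight z p
    · exact hp.trans ((by simp : pHeight z p ≤ pHeight z p + (0 : ℕ)).trans
        (pHeight_add_le z p (by simp)))
    · have hd : (p : ℕ) ^ (pHeight x p).toNat ∣ m :=
        Finset.dvd_prod_of_mem (fun p : Nat.Primes => (p : ℕ) ^ (pHeight x p).toNat)
          (h.1.mem_toFinset.2 hp)
      refine le_trans ?_ (pHeight_add_le z p hd)
      rw [ENat.natCast_toNat (h.2 p hp)]
      exact le_add_self
  have hmz : m • z ≠ 0 := fun h0 => hz ((smul_eq_zero.1 h0).resolve_left hm)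
  obtain ⟨y, hy, hk, hy0⟩ := exists_telescope (pHeight x) hx le_rfl
  obtain ⟨w, hw, hl, hw0⟩ := exists_telescope (pHeight x) hmz hle
  exact exists_injective_of_telescope _ y hk hy0 (hS.exists_eq_zsmul hx y hy) w hl hw0

theorem CotorsionTheory.cogeneratedByGroup_le {S T : Type u} [AddCommGroup S] [AddCommGroup T]
    (hS : IsRankOne S) (hT : IsRankOne T) (h : hS.type ≤ hT.type) :
    cogeneratedByGroup T ≤ cogeneratedByGroup S := by
  obtain ⟨j, hj⟩ := hS.exists_injective hT h
  intro X hX A hA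
  rw [Set.mem_singleton_iff.1 hA]
  exact (hX _ rfl).of_injective j hj

/-! ### Existence of rank-1 groups of a given type -/

/-- The group of rational numbers whose denominators are admitted by `χ`. -/
def Characteristic.rationalGroup (χ : Characteristic) : AddSubgroup ℚ where
  carrier := {x | ∃ (n : ℕ) (c : ℤ), χ.denom n * x = c}
  zero_mem' := ⟨0, 0, by simp⟩
  neg_mem' := by
    rintro x ⟨n, c, h⟩
    exact ⟨n, -c, by push_cast; rw [← h]; ring⟩
  add_mem' := by
    rintro x y ⟨n, c, h⟩ ⟨m, d, k⟩
    obtain ⟨a, ha⟩ := χ.denom_dvd_denom (le_max_left n m)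
    obtain ⟨b, hb⟩ := χ.denom_dvd_denom (le_max_right n m)
    refine ⟨max n m, a * c + b * d, ?_⟩
    push_cast
    rw [mul_add, ← h, ← k]
    nth_rewrite 1 [ha]
    rw [hb]
    push_cast
    ring

theorem isRankOne_of_injective {T : Type u} [AddCommGroup T] [Nontrivial T] (f : T →+ ℚ)
    (hf : Function.Injective f) : IsRankOne T := by
  have htf : IsAddTorsionFree T := hf.isAddTorsionFree f
  refine ⟨htf, le_antisymm ?_ ?_⟩
  · have h1 := LinearMap.lift_rank_le_of_injective f.toIntLinearMap hf
    rw [← IsFractionRing.rank_right_eq ℤ ℚ ℚ, CommSemiring.rank_self] at h1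
    simpa using h1
  · exact Cardinal.one_le_iff_pos.2 rank_pos

/-- In `rationalGroup` the element `1` is divisible by `p ^ e` exactly when `χ` admits `p ^ e`, so
its height sequence is `χ` itself. -/
theorem Characteristic.exists_isRankOne (χ : Characteristic) :
    ∃ (T : Type u) (_ : AddCommGroup T) (hT : IsRankOne T), hT.type = GroupType.mk χ := by
  have h1 : (1 : ℚ) ∈ χ.rationalGroup := ⟨0, χ.denom 0, by simp⟩
  let f : ULift.{u} χ.rationalGroup →+ ℚ :=
    χ.rationalGroup.subtype.comp AddEquiv.ulift.toAddMonoidHom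
  have hf : Function.Injective f := Subtype.val_injective.comp ULift.down_injective
  have : Nontrivial (ULift.{u} χ.rationalGroup) :=
    ⟨⟨⟨1, h1⟩⟩, 0, fun h => one_ne_zero (congrArg f h)⟩
  have hT := isRankOne_of_injective f hf
  refine ⟨_, _, hT, ?_⟩
  rw [← hT.type_eq ⟨⟨1, h1⟩⟩ fun h => one_ne_zero (congrArg f h), elementType]
  congr 1
  funext p
  have hp : ((p : ℕ) : ℚ) ≠ 0 := by exact_mod_cast p.2.ne_zero
  refine ENat.eq_of_forall_natCast_le_iff fun e => ?_
  rw [le_pHeight_iff]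
  constructor
  · rintro ⟨y, hy⟩
    obtain ⟨n, c, hc⟩ := y.down.2
    have hy' : (p : ℚ) ^ e * y.down = 1 := by
      have := congrArg f hy
      rw [map_nsmul, nsmul_eq_mul] at this
      exact_mod_cast this
    refine (χ.admits_denom n).2 p e ?_
    have : ((χ.denom n : ℤ) : ℚ) = ((p : ℕ) ^ e * c : ℤ) := by
      push_cast
      rw [← hc, mul_left_comm, hy', mul_one]
    exact Int.natCast_dvd_natCast.1 ⟨c, by push_cast; exact_mod_cast this⟩
  · intro h
    obtain ⟨c, hc⟩ := (Characteristic.admits_prime_pow.2 h).dvd_denom le_rfl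
    refine ⟨⟨⟨((p : ℚ) ^ e)⁻¹, (p : ℕ) ^ e, c, ?_⟩⟩, hf ?_⟩
    · rw [hc]
      push_cast
      field_simp
    · rw [map_nsmul, nsmul_eq_mul]
      change (((p : ℕ) ^ e : ℕ) : ℚ) * ((p : ℚ) ^ e)⁻¹ = 1
      push_cast
      exact mul_inv_cancel₀ (pow_ne_zero _ hp)

/-! ### Solvability of telescopes -/

theorem telescopeSolvable_ulift_iff {k : ℕ → ℕ} {X : Type} [AddCommGroup X] :
    TelescopeSolvable k (ULift.{u} X) ↔ TelescopeSolvable k X := by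
  constructor
  · intro h a
    obtain ⟨b, hb⟩ := h fun n => ⟨a n⟩
    exact ⟨fun n => (b n).down, fun n => congrArg ULift.down (hb n)⟩
  · intro h a
    obtain ⟨b, hb⟩ := h fun n => (a n).down
    exact ⟨fun n => ⟨b n⟩, fun n => congrArg ULift.up (hb n)⟩

theorem TelescopeSolvable.pi {ι : Type*} {X : ι → Type*} [∀ i, AddCommGroup (X i)] {k : ℕ → ℕ}
    (h : ∀ i, TelescopeSolvable k (X i)) : TelescopeSolvable k (∀ i, X i) := by
  intro a
  choose b hb using fun i => h i fun n => a n i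
  exact ⟨fun n i => b i n, fun n => funext fun i => hb i n⟩

/-- Where the `k n` act surjectively, solve forwards from `b 0 = 0`; the first `N` terms are then
computed backwards, which needs no division. -/
theorem telescopeSolvable_of_surjective {X : Type u} [AddCommGroup X] (N : ℕ) :
    ∀ k : ℕ → ℕ, (∀ n, N ≤ n → Function.Surjective fun x : X => k n • x) →
      TelescopeSolvable k X := by
  induction N with
  | zero =>
    intro k hk a
    choose f hf using fun n => hk n n.zero_le
    let b : ℕ → X := fun n => Nat.rec 0 (fun n x => f n (x - a n)) n
    refine ⟨b, fun n => ?_⟩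
    have : k n • b (n + 1) = b n - a n := hf n (b n - a n)
    rw [this, sub_sub_cancel]
  | succ N ih =>
    intro k hk a
    obtain ⟨b, hb⟩ := ih (fun n => k (n + 1)) (fun n hn => hk (n + 1) (by omega))
      fun n => a (n + 1)
    refine ⟨fun n => Nat.casesOn n (a 0 + k 0 • b 0) b, fun n => ?_⟩
    rcases n with _ | n
    · exact add_sub_cancel_right _ _
    · exact hb n

/-- An element that is divisible by the product of the first `N` numbers `k n` starts a compatible
sequence if the remaining `k n` act surjectively. -/
theorem exists_compatible_of_surjective {X : Type u} [AddCommGroup X] (N : ℕ) :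
    ∀ k : ℕ → ℕ, (∀ n, N ≤ n → Function.Surjective fun x : X => k n • x) → ∀ w : X,
      ∃ d : ℕ → X, d 0 = (∏ i ∈ Finset.range N, k i) • w ∧ ∀ n, d n = k n • d (n + 1) := by
  induction N with
  | zero =>
    intro k hk w
    choose f hf using fun n => hk n n.zero_le
    exact ⟨fun n => Nat.rec w (fun n x => f n x) n, by simp, fun n => (hf n _).symm⟩
  | succ N ih =>
    intro k hk w
    obtain ⟨d, hd0, hd⟩ := ih (fun n => k (n + 1)) (fun n hn => hk (n + 1) (by omega)) w
    refine ⟨fun n => Nat.casesOn n (k 0 • d 0) d, ?_, fun n => ?_⟩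
    · change k 0 • d 0 = _
      rw [hd0, smul_smul, Finset.prod_range_succ']
      congr 1
      ring
    · rcases n with _ | n
      · rfl
      · exact hd n

/-- In a countable torsion-free group, `lim¹` does not vanish if some element is not divisible by
infinitely many of the `k n`. -/
theorem not_telescopeSolvable_of_countable {X : Type u} [AddCommGroup X] [IsAddTorsionFree X]
    [Countable X] {k : ℕ → ℕ} (hk : ∀ n, k n ≠ 0) (u : X)
    (hJ : {n | ∀ w, k n • w ≠ u}.Infinite) : ¬ TelescopeSolvable k X := by
  classical
  intro h
  have hJ' := hJ.to_subtype
  -- Each set `A` of bad indices gives a right-hand side. If the solutions for `A` and `B` have the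
  -- same start, then at the first difference `u` would be a multiple of `k n` for a bad `n`. So `A`
  -- is recovered from an element of the countable group `X`.
  let a : Set {n | ∀ w, k n • w ≠ u} → ℕ → X := fun A n => if n ∈ Subtype.val '' A then u else 0
  choose b hb using fun A => h (a A)
  have hinj : Function.Injective fun A => b A 0 := by
    intro A B h0
    have step : ∀ n, b A n = b B n → a A n = a B n := by
      intro n hn
      have hdiff : k n • (b B (n + 1) - b A (n + 1)) = a A n - a B n := by
        rw [← hb A n, ← hb B n, hn, smul_sub]
        abel
      have hdiff' : k n • (b A (n + 1) - b B (n + 1)) = a B n - a A n := by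
        rw [← neg_sub, smul_neg, hdiff, neg_sub]
      simp only [a] at hdiff hdiff' ⊢
      split_ifs at hdiff hdiff' ⊢ with hA hB hB
      · rfl
      · obtain ⟨j, -, rfl⟩ := hA
        exact (j.2 _ (hdiff.trans (sub_zero u))).elim
      · obtain ⟨j, -, rfl⟩ := hB
        exact (j.2 _ (hdiff'.trans (sub_zero u))).elim
      · rfl
    have hall : ∀ n, b A n = b B n := by
      intro n
      induction n with
      | zero => exact h0
      | succ n ih =>
        apply nsmul_right_injective (hk n)
        have h1 := hb A n
        rw [step n ih, ← hb B n, ih] at h1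
        exact sub_right_injective h1
    have hu : u ≠ 0 := by
      rintro rfl
      obtain ⟨n, hn⟩ := hJ.nonempty
      exact hn 0 (smul_zero _)
    ext j
    have := step j (hall j)
    simp only [a, Subtype.val_injective.mem_set_image] at this
    by_cases hA : j ∈ A <;> by_cases hB : j ∈ B <;> simp_all
  obtain ⟨e, he⟩ := exists_injective_nat X
  exact Function.cantor_injective _
    (((Infinite.natEmbedding {n | ∀ w, k n • w ≠ u}).injective.comp he).comp hinj)

/-! ### Prime divisors of the ratios -/

namespace Characteristic

theorem prod_ratio (χ : Characteristic) (N : ℕ) :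
    ∏ i ∈ Finset.range N, χ.ratio i = χ.denom N := by
  induction N with
  | zero => simp [denom_zero]
  | succ N ih => rw [Finset.prod_range_succ, ih, denom_succ]

/-- Once the full admitted power of `p` divides the denominators, a further factor `p` would not be
admitted. -/
theorem exists_forall_not_dvd_ratio {χ : Characteristic} {p : Nat.Primes} (h : χ p ≠ ⊤) :
    ∃ N, ∀ n, N ≤ n → ¬ (p : ℕ) ∣ χ.ratio n := by
  obtain ⟨e, he⟩ := ENat.ne_top_iff_exists.1 h
  refine ⟨(p : ℕ) ^ e, fun n hn hd => ?_⟩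
  have h1 : (p : ℕ) ^ e ∣ χ.denom n := (admits_prime_pow.2 he.le).dvd_denom hn
  have h2 : (p : ℕ) ^ (e + 1) ∣ χ.denom (n + 1) := by
    rw [denom_succ, pow_succ]; exact mul_dvd_mul h1 hd
  have h3 := (χ.admits_denom (n + 1)).2 p (e + 1) h2
  rw [← he] at h3
  have : e + 1 ≤ e := by exact_mod_cast h3
  omega

/-- Otherwise the `p`-part of the denominators would stabilize, although every power of `p`
eventually divides them. -/
theorem infinite_dvd_ratio {χ : Characteristic} {p : Nat.Primes} (h : χ p = ⊤) :
    {n | (p : ℕ) ∣ χ.ratio n}.Infinite := by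
  rw [Set.infinite_iff_exists_gt]
  intro N
  by_contra! hN
  have key : ∀ e d, (p : ℕ) ^ e ∣ χ.denom (N + 1 + d) → (p : ℕ) ^ e ∣ χ.denom (N + 1) := by
    intro e d
    induction d with
    | zero => exact id
    | succ d ih =>
      intro hd
      rw [← add_assoc, denom_succ] at hd
      refine ih (Nat.Coprime.dvd_of_dvd_mul_right (Nat.Coprime.pow_left _ ?_) hd)
      rw [p.2.coprime_iff_not_dvd]
      intro hdvd
      have := hN _ hdvd
      omega
  -- With this exponent `p ^ e` exceeds the number it would have to divide.
  set e := χ.denom (N + 1) with he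
  have h1 : (p : ℕ) ^ e ∣ χ.denom (N + 1 + (p : ℕ) ^ e) :=
    (admits_prime_pow.2 (h ▸ le_top)).dvd_denom (by omega)
  have h2 := Nat.le_of_dvd (Nat.pos_of_ne_zero (χ.denom_ne_zero _)) (key e _ h1)
  have h3 : e < (p : ℕ) ^ e := Nat.lt_pow_self p.2.one_lt
  omega

end Characteristic

/-! ### A group separating types that differ by an infinite entry -/

/-- The group of rational numbers with denominator prime to `p`. -/
def localizedInt (p : ℕ) [Fact p.Prime] : AddSubgroup ℚ where
  carrier := {x | padicNorm p x ≤ 1}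
  zero_mem' := by simp
  neg_mem' {x} h := by simpa using h
  add_mem' {x y} hx hy := padicNorm.nonarchimedean.trans (max_le hx hy)

theorem mem_localizedInt {p : ℕ} [Fact p.Prime] {x : ℚ} :
    x ∈ localizedInt p ↔ padicNorm p x ≤ 1 := Iff.rfl

/-- All but finitely many ratios are prime to `p`, hence invertible in the localization. -/
theorem telescopeSolvable_localizedInt {χ : Characteristic} {p : Nat.Primes} [Fact (p : ℕ).Prime]
    (h : χ p ≠ ⊤) : TelescopeSolvable χ.ratio (localizedInt p) := by
  obtain ⟨N, hN⟩ := Characteristic.exists_forall_not_dvd_ratio h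
  refine telescopeSolvable_of_surjective N _ fun n hn x => ?_
  have h1 : padicNorm p (χ.ratio n : ℚ) = 1 := (padicNorm.nat_eq_one_iff _).2 (hN n hn)
  refine ⟨⟨x / χ.ratio n, ?_⟩, Subtype.ext ?_⟩
  · rw [mem_localizedInt, padicNorm.div, h1, div_one]
    exact x.2
  · change χ.ratio n • ((x : ℚ) / χ.ratio n) = x
    rw [nsmul_eq_mul]
    exact mul_div_cancel₀ _ (by exact_mod_cast χ.ratio_ne_zero n)

/-- Infinitely many ratios are divisible by `p`, and `1` is divisible by none of these. -/
theorem not_telescopeSolvable_localizedInt {χ : Characteristic} {p : Nat.Primes}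
    [Fact (p : ℕ).Prime] (h : χ p = ⊤) : ¬ TelescopeSolvable χ.ratio (localizedInt p) := by
  have h1 : (1 : ℚ) ∈ localizedInt p := by simp [mem_localizedInt]
  refine not_telescopeSolvable_of_countable χ.ratio_ne_zero ⟨1, h1⟩
    ((Characteristic.infinite_dvd_ratio h).mono fun n hn w hw => ?_)
  have hw' : (χ.ratio n : ℚ) * w = 1 := by
    have := congrArg Subtype.val hw
    rwa [AddSubgroup.coe_nsmul, nsmul_eq_mul] at this
  have h2 : padicNorm p (χ.ratio n : ℚ) < 1 := (padicNorm.nat_lt_one_iff _).2 hn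
  have h3 := congrArg (padicNorm p) hw'
  rw [padicNorm.mul, padicNorm.one] at h3
  have h4 : padicNorm p (w : ℚ) ≤ 1 := w.2
  nlinarith [padicNorm.nonneg (p := p) (χ.ratio n : ℚ), padicNorm.nonneg (p := p) (w : ℚ)]

/-! ### A group separating types that differ at infinitely many entries -/

section Product

variable (P : Set Nat.Primes) (t : Nat.Primes → ℕ)

/-- The product of the cyclic groups of order `p ^ (t p + 1)` for `p ∈ P`. -/
abbrev PrimePowerProduct : Type := ∀ p : P, ZMod ((p.1 : ℕ) ^ (t p.1 + 1))

/-- The element of the product with coordinates `p ^ t p`. -/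
def socleElement : PrimePowerProduct P t :=
  fun p => ((p.1 : ℕ) : ZMod ((p.1 : ℕ) ^ (t p.1 + 1))) ^ t p.1

variable {P t}

/-- The element with coordinates `p ^ t p` has infinite order and thus can be mapped to `1 ∈ ℚ`. -/
theorem exists_toRat (hP : P.Infinite) :
    ∃ φ : PrimePowerProduct P t →ₗ[ℤ] ℚ, φ (socleElement P t) = 1 := by
  have hz : Function.Injective
      (LinearMap.toSpanSingleton ℤ (PrimePowerProduct P t) (socleElement P t)) := by
    rw [← LinearMap.ker_eq_bot, LinearMap.ker_eq_bot']
    -- A vanishing multiple forces every `p ∈ P` to divide `n`.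
    intro n hn
    by_contra h0
    apply hP
    have hfin : {p : Nat.Primes | (p : ℕ) ∈ n.natAbs.primeFactors}.Finite :=
      (Finset.finite_toSet n.natAbs.primeFactors).preimage Nat.Primes.coe_nat_injective.injOn
    refine hfin.subset fun p hp => Nat.mem_primeFactors.2 ⟨p.2, ?_, Int.natAbs_ne_zero.2 h0⟩
    have h1 : n • ((p : ℕ) : ZMod ((p : ℕ) ^ (t p + 1))) ^ t p = 0 := congrFun hn ⟨p, hp⟩
    have h2 : ((n * (p : ℕ) ^ t p : ℤ) : ZMod ((p : ℕ) ^ (t p + 1))) = 0 := by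
      rw [zsmul_eq_mul] at h1
      push_cast
      exact h1
    rw [ZMod.intCast_zmod_eq_zero_iff_dvd] at h2
    push_cast at h2
    rw [pow_succ'] at h2
    exact Int.natCast_dvd.1 (Int.dvd_of_mul_dvd_mul_right
      (pow_ne_zero _ (by exact_mod_cast p.2.ne_zero)) h2)
  obtain ⟨φ, hφ⟩ := (Module.Baer.of_divisible ℚ).extension_property _ hz
    (LinearMap.toSpanSingleton ℤ ℚ 1)
  refine ⟨φ, ?_⟩
  have := LinearMap.congr_fun hφ 1
  simpa using this

theorem isUnit_natCast_zmod_prime_pow {p a : ℕ} (e : ℕ) (hp : p.Prime) (h : ¬ p ∣ a) :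
    IsUnit (a : ZMod (p ^ e)) :=
  (ZMod.isUnit_iff_coprime _ _).2 (((hp.coprime_iff_not_dvd.2 h).pow_left e).symm)

theorem surjective_nsmul_zmod_prime_pow {p a : ℕ} (e : ℕ) (hp : p.Prime) (h : ¬ p ∣ a) :
    Function.Surjective fun x : ZMod (p ^ e) => a • x := by
  intro x
  obtain ⟨v, hv⟩ := (isUnit_natCast_zmod_prime_pow e hp h).exists_right_inv
  exact ⟨v * x, by simp only [nsmul_eq_mul]; rw [← mul_assoc, hv, one_mul]⟩

/-- `φ` maps the multiples of `socleElement` onto `ℚ`. -/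
theorem exists_toRat_socle_eq (φ : PrimePowerProduct P t →ₗ[ℤ] ℚ)
    (hφ : φ (socleElement P t) = 1) (r : ℚ) :
    ∃ u : PrimePowerProduct P t, φ (socleElement P t * u) = r := by
  -- Take `v` inverse to `r.den` where possible and `0` at the primes dividing `r.den`. There the
  -- extra factor `r.den` kills the right side too; it is cancelled later in `ℚ`.
  have hex : ∀ p : P, ∃ v : ZMod ((p.1 : ℕ) ^ (t p.1 + 1)),
      (r.den : ZMod ((p.1 : ℕ) ^ (t p.1 + 1))) * r.den * (socleElement P t p * v) =
        r.den * socleElement P t p := by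
    intro p
    by_cases h : (p.1 : ℕ) ∣ r.den
    · refine ⟨0, ?_⟩
      obtain ⟨c, hc⟩ := h
      have : (((p.1 : ℕ) : ZMod ((p.1 : ℕ) ^ (t p.1 + 1)))) ^ (t p.1 + 1) = 0 := by
        rw [← Nat.cast_pow, ZMod.natCast_self]
      rw [mul_zero, mul_zero, hc, Nat.cast_mul, mul_right_comm, socleElement, ← pow_succ', this,
        zero_mul]
    · obtain ⟨v, hv⟩ := (isUnit_natCast_zmod_prime_pow (t p.1 + 1) p.1.2 h).exists_right_inv
      refine ⟨v, ?_⟩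
      linear_combination (r.den : ZMod ((p.1 : ℕ) ^ (t p.1 + 1))) * socleElement P t p * hv
  choose v hv using hex
  have h1 : (r.den * r.den) • (socleElement P t * v) = r.den • socleElement P t := by
    funext p
    simpa using hv p
  have h2 := congrArg φ h1
  rw [map_nsmul, map_nsmul, hφ, nsmul_eq_mul, nsmul_eq_mul, mul_one] at h2
  have hden : (r.den : ℚ) ≠ 0 := by exact_mod_cast r.den_ne_zero
  refine ⟨r.num • v, ?_⟩
  rw [mul_smul_comm, map_zsmul, zsmul_eq_mul]
  push_cast at h2
  have h4 : φ (socleElement P t * v) * r.den = 1 := by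
    apply mul_left_cancel₀ hden
    linear_combination h2
  rw [eq_div_of_mul_eq hden h4, mul_one_div, Rat.num_div_den]

/-- The `p`-part of the product of the early ratios divides `p ^ s` and the rest is a unit, so `p ^
s * u` can be divided by that product; the later ratios are units. -/
theorem exists_compatible_zmod {χ : Characteristic} {p : Nat.Primes} {s : ℕ} (h : χ p ≤ s)
    (u : ZMod ((p : ℕ) ^ (s + 1))) :
    ∃ d : ℕ → ZMod ((p : ℕ) ^ (s + 1)), d 0 = ((p : ℕ) : ZMod _) ^ s * u ∧
      ∀ n, d n = χ.ratio n • d (n + 1) := by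
  obtain ⟨N, hN⟩ := Characteristic.exists_forall_not_dvd_ratio
    (ne_top_of_le_ne_top (ENat.natCast_ne_top s) h)
  have hD := χ.denom_ne_zero N
  obtain ⟨v, m, hm, hvm⟩ := Nat.exists_eq_pow_mul_and_not_dvd hD p p.2.ne_one
  have hv : v ≤ s := by
    exact_mod_cast ((χ.admits_denom N).2 p v ⟨m, hvm⟩).trans h
  obtain ⟨m', hm'⟩ := (isUnit_natCast_zmod_prime_pow (s + 1) p.2 hm).exists_right_inv
  obtain ⟨d, hd0, hd⟩ := exists_compatible_of_surjective N χ.ratio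
    (fun n hn => surjective_nsmul_zmod_prime_pow (s + 1) p.2 (hN n hn))
    (((p : ℕ) : ZMod _) ^ (s - v) * m' * u)
  refine ⟨d, ?_, hd⟩
  rw [hd0, χ.prod_ratio, hvm, nsmul_eq_mul]
  push_cast
  have hpow : ((p : ℕ) : ZMod ((p : ℕ) ^ (s + 1))) ^ v * ((p : ℕ) : ZMod _) ^ (s - v) =
      ((p : ℕ) : ZMod _) ^ s := by
    rw [← pow_add, Nat.add_sub_cancel' hv]
  rw [← hpow]
  linear_combination ((p : ℕ) : ZMod ((p : ℕ) ^ (s + 1))) ^ v * ((p : ℕ) : ZMod _) ^ (s - v) * u * hm'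

/-- Equations are solvable coordinatewise in the product. Subtracting a compatible sequence, which
solves the homogeneous equations, moves the solution into the kernel. -/
theorem telescopeSolvable_ker_toRat (φ : PrimePowerProduct P t →ₗ[ℤ] ℚ)
    (hφ : φ (socleElement P t) = 1) {χ : Characteristic}
    (hχ : ∀ p ∈ P, χ p ≤ t p) : TelescopeSolvable χ.ratio (LinearMap.ker φ) := by
  have hprod : TelescopeSolvable χ.ratio (PrimePowerProduct P t) := by
    refine TelescopeSolvable.pi fun p => ?_
    obtain ⟨N, hN⟩ := Characteristic.exists_forall_not_dvd_ratio
      (ne_top_of_le_ne_top (ENat.natCast_ne_top _) (hχ p p.2))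
    exact telescopeSolvable_of_surjective N _
      fun n hn => surjective_nsmul_zmod_prime_pow _ p.1.2 (hN n hn)
  intro a
  obtain ⟨b, hb⟩ := hprod fun n => a n
  -- The correction starts at `socleElement P t * u`, with `u` chosen to make `φ (c 0) = 0`.
  obtain ⟨u, hu⟩ := exists_toRat_socle_eq φ hφ (φ (b 0))
  choose d hd0 hd using fun p : P => exists_compatible_zmod (hχ p p.2) (u p)
  let c : ℕ → PrimePowerProduct P t := fun n => b n - (fun p => d p n : PrimePowerProduct P t)
  have hc : ∀ n, c n - χ.ratio n • c (n + 1) = a n := by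
    intro n
    have h1 : (fun p => d p n) = χ.ratio n • fun p => d p (n + 1) := funext fun p => hd p n
    simp only [c]
    rw [h1, smul_sub, ← hb n]
    abel
  -- Only the start matters: the equations and torsion-freeness of `ℚ` carry membership from `n` to
  -- `n + 1`.
  have hmem : ∀ n, c n ∈ LinearMap.ker φ := by
    intro n
    induction n with
    | zero =>
      have h1 : (fun p => d p 0) = socleElement P t * u :=
        funext fun p => hd0 p
      simp only [c]
      rw [LinearMap.mem_ker, map_sub, h1, hu, sub_self]
    | succ n ih =>
      have h1 : φ (c n - χ.ratio n • c (n + 1)) = 0 := by rw [hc]; exact (a n).2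
      rw [map_sub, LinearMap.mem_ker.1 ih, zero_sub, neg_eq_zero, map_nsmul, smul_eq_zero] at h1
      exact h1.resolve_left (χ.ratio_ne_zero n)
  exact ⟨fun n => ⟨c n, hmem n⟩, fun n => Subtype.ext (hc n)⟩

/-- Lifts `c n` of the inverse denominators satisfy the homogeneous equations modulo the kernel. A
solution there would correct them to a compatible sequence `d` with `φ (d 0) = 1`, but `d 0` is
divisible by every `p ^ (t p + 1)` with `p ∈ P`, hence zero. -/
theorem not_telescopeSolvable_ker_toRat (φ : PrimePowerProduct P t →ₗ[ℤ] ℚ)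
    (hφ : φ (socleElement P t) = 1) {χ : Characteristic}
    (hχ : ∀ p ∈ P, (t p : ℕ∞) < χ p) : ¬ TelescopeSolvable χ.ratio (LinearMap.ker φ) := by
  intro h
  have hsurj : ∀ n, ∃ c, φ c = (χ.denom n : ℚ)⁻¹ := fun n =>
    ⟨_, (exists_toRat_socle_eq φ hφ _).choose_spec⟩
  choose c hc using hsurj
  have hmem : ∀ n, c n - χ.ratio n • c (n + 1) ∈ LinearMap.ker φ := by
    intro n
    have h1 : (χ.denom n : ℚ) ≠ 0 := by exact_mod_cast χ.denom_ne_zero n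
    have h2 : (χ.ratio n : ℚ) ≠ 0 := by exact_mod_cast χ.ratio_ne_zero n
    rw [LinearMap.mem_ker, map_sub, map_nsmul, hc, hc, χ.denom_succ, nsmul_eq_mul]
    push_cast
    field_simp
    simp
  obtain ⟨b, hb⟩ := h fun n => ⟨_, hmem n⟩
  have hb' : ∀ n, (b n : PrimePowerProduct P t) - χ.ratio n • (b (n + 1)).1 =
      c n - χ.ratio n • c (n + 1) := fun n => congrArg Subtype.val (hb n)
  let d : ℕ → PrimePowerProduct P t := fun n => c n - b n
  have hd : ∀ n, d n = χ.ratio n • d (n + 1) := by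
    intro n
    simp only [d]
    rw [smul_sub, sub_eq_sub_iff_sub_eq_sub]
    exact (hb' n).symm
  have hd0 : ∀ n, d 0 = χ.denom n • d n := by
    intro n
    induction n with
    | zero => rw [χ.denom_zero, one_smul]
    | succ n ih => rw [ih, hd n, smul_smul, χ.denom_succ]
  have hzero : d 0 = 0 := by
    funext p
    have hadm : χ.Admits ((p.1 : ℕ) ^ (t p.1 + 1)) :=
      Characteristic.admits_prime_pow.2 (by
        push_cast
        exact Order.add_one_le_of_lt (hχ p p.2))
    obtain ⟨m, hm⟩ := hadm.dvd_denom le_rfl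
    rw [hd0 ((p.1 : ℕ) ^ (t p.1 + 1)), Pi.smul_apply, nsmul_eq_mul, hm, Nat.cast_mul,
      ZMod.natCast_self, zero_mul, zero_mul, Pi.zero_apply]
  have h1 : φ (d 0) = 1 := by
    simp only [d]
    rw [map_sub, hc, χ.denom_zero, LinearMap.mem_ker.1 (b 0).2]
    simp
  rw [hzero, map_zero] at h1
  exact zero_ne_one h1

end Product

/-! ### The anti-isomorphism -/

theorem exists_separating_of_not_almostLE {χ ψ : Characteristic} (h : ¬ χ.AlmostLE ψ) :
    ∃ (X : Type) (_ : AddCommGroup X), TelescopeSolvable ψ.ratio X ∧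
      ¬ TelescopeSolvable χ.ratio X := by
  by_cases hfin : {p | ¬ χ p ≤ ψ p}.Finite
  · have : ∃ p, ¬ χ p ≤ ψ p ∧ χ p = ⊤ := by
      by_contra! hc
      exact h ⟨hfin, fun p hp => hc p (not_le.1 hp)⟩
    obtain ⟨p, hp, htop⟩ := this
    have : Fact (p : ℕ).Prime := ⟨p.2⟩
    exact ⟨localizedInt p, inferInstance,
      telescopeSolvable_localizedInt fun ht => hp (ht ▸ le_top),
      not_telescopeSolvable_localizedInt htop⟩
  -- Here `P` is the exceptional set and `t` is `ψ`, which is finite on `P` because it lies strictly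
  -- below `χ`.
  · obtain ⟨φ, hφ⟩ := exists_toRat (t := fun p => (ψ p).toNat) (Set.not_finite.1 hfin)
    have hψ : ∀ p ∈ {p | ¬ χ p ≤ ψ p}, ((ψ p).toNat : ℕ∞) = ψ p := fun p hp =>
      ENat.natCast_toNat (not_le.1 hp).ne_top
    exact ⟨LinearMap.ker φ, inferInstance,
      telescopeSolvable_ker_toRat φ hφ fun p hp => (hψ p hp).ge,
      not_telescopeSolvable_ker_toRat φ hφ fun p hp => by
        rw [hψ p hp]; exact not_le.1 hp⟩

namespace CotorsionTheory

theorem cogeneratedByGroup_le_iff {S T : Type u} [AddCommGroup S] [AddCommGroup T]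
    (hS : IsRankOne S) (hT : IsRankOne T) :
    cogeneratedByGroup T ≤ cogeneratedByGroup S ↔ hS.type ≤ hT.type := by
  refine ⟨fun h => ?_, cogeneratedByGroup_le hS hT⟩
  obtain ⟨x, hx⟩ := hS.exists_ne_zero
  obtain ⟨z, hz⟩ := hT.exists_ne_zero
  rw [← hS.type_eq x hx, ← hT.type_eq z hz, elementType, elementType, GroupType.mk_le_mk]
  by_contra hle
  obtain ⟨X, _, hXT, hXS⟩ := exists_separating_of_not_almostLE hle
  have hmem : ModuleCat.of ℤ (ULift.{u} X) ∈ (cogeneratedByGroup T).cotorsionClass := by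
    intro A hA
    rw [Set.mem_singleton_iff.1 hA]
    exact (hT.extVanishes_iff hz).2 (telescopeSolvable_ulift_iff.2 hXT)
  exact hXS (telescopeSolvable_ulift_iff.1 ((hS.extVanishes_iff hx).1 (h hmem _ rfl)))

theorem cogeneratedByGroup_eq {S T : Type u} [AddCommGroup S] [AddCommGroup T]
    (hS : IsRankOne S) (hT : IsRankOne T) (h : hS.type = hT.type) :
    cogeneratedByGroup S = cogeneratedByGroup T :=
  le_antisymm ((cogeneratedByGroup_le_iff hT hS).2 h.ge) ((cogeneratedByGroup_le_iff hS hT).2 h.le)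

end CotorsionTheory

theorem GroupType.exists_isRankOne (τ : GroupType) :
    ∃ (T : Type u) (_ : AddCommGroup T) (hT : IsRankOne T), hT.type = τ := by
  induction τ using Quotient.inductionOn with | _ χ => exact χ.exists_isRankOne

theorem theorem1p11 :
    ∃ Φ : GroupType ≃o (RationalCotorsionTheory.{u})ᵒᵈ,
      (∀ (T : Type u) [AddCommGroup T] (hT : IsRankOne T),
        (OrderDual.ofDual (Φ hT.type)).val = CotorsionTheory.cogeneratedByGroup T) ∧
      (∀ σ τ : GroupType,
        IsGLB {OrderDual.ofDual (Φ σ), OrderDual.ofDual (Φ τ)} (OrderDual.ofDual (Φ (σ ⊔ τ))) ∧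
        IsLUB {OrderDual.ofDual (Φ σ), OrderDual.ofDual (Φ τ)} (OrderDual.ofDual (Φ (σ ⊓ τ)))) := by
  -- The choice of representatives is harmless: groups of equal type cogenerate the same theory.
  choose G hG hR htype using GroupType.exists_isRankOne.{u}
  let f : GroupType → (RationalCotorsionTheory.{u})ᵒᵈ := fun τ =>
    OrderDual.toDual ⟨CotorsionTheory.cogeneratedByGroup (G τ), G τ, hG τ, hR τ, rfl⟩
  have hf : ∀ (T : Type u) [AddCommGroup T] (hT : IsRankOne T),
      (OrderDual.ofDual (f hT.type)).val = CotorsionTheory.cogeneratedByGroup T :=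
    fun T _ hT => CotorsionTheory.cogeneratedByGroup_eq (hR _) hT (htype _)
  have hle : ∀ {σ τ : GroupType}, f σ ≤ f τ ↔ σ ≤ τ := fun {σ τ} =>
    (CotorsionTheory.cogeneratedByGroup_le_iff (hR σ) (hR τ)).trans (by rw [htype, htype])
  have hsurj : Function.Surjective f := by
    rintro ⟨P, T, _, hT, rfl⟩
    exact ⟨hT.type, Subtype.ext (hf T hT)⟩
  let Φ : GroupType ≃o (RationalCotorsionTheory.{u})ᵒᵈ :=
    RelIso.ofSurjective (OrderEmbedding.ofMapLEIff f fun _ _ => hle) hsurj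
  refine ⟨Φ, hf, fun σ τ => ⟨?_, ?_⟩⟩
  -- An order isomorphism preserves least upper bounds, and those in the dual order are greatest
  -- lower bounds.
  · have h := Φ.isLUB_image'.2 (isLUB_pair (a := σ) (b := τ))
    rw [Set.image_pair] at h
    exact h
  · have h := Φ.isGLB_image'.2 (isGLB_pair (a := σ) (b := τ))
    rw [Set.image_pair] at h
    exact h
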